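/- Let $a<b$ be real numbers. Let $\mathcal F$ be the set of functions $f:[a,b]\to(0,\infty)$ with $\operatorname{TV}(\log f)<\infty$ and $\int_a^b f\,dx=1$, where $\operatorname{TV}(g)$ is the supremum of $\sum_i|g(z_{i+1})-g(z_i)|$ over finite sets of points $z_1<z_2<\dots<z_m$ in $[a,b]$. Fix $f_0\in\mathcal F$. For $f\in\mathcal F$ put $$J(f)=1+\operatorname{TV}(\log f)+\operatorname{TV}(\log f_0),\qquad p_f=\tfrac12\log\frac{f+f_0}{2f_0},\qquad h(f,f_0)=\Big(\tfrac12\int_a^b\big(\sqrt f-\sqrt{f_0}\big)^2dx\Big)^{1/2}.$$ Let $x_1,\dots,x_n$ be independent random variables with density $f_0$, $P$ their common law, $P_n(g)=\frac1n\sum_{i=1}^n g(x_i)$ and $P(g)=\int g\,dP$, and let $$Z_n=\sup\Big\{\frac{n^{2/3}\,|(P_n-P)(p_f)|}{J(f)}\;:\;f\in\mathcal F,\ h(f,f_0)\le n^{-1/3}J(f)\Big\}.$$ Then: 1. $Z_n=O_P(1)$, that is, for every $\varepsilon>0$ there are $K\in\mathbb R$ and $N\in\mathbb N$ such that $\mathbb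 P(Z_n>K)<\varepsilon$ for all $n\ge N$. 2. There are $n_0\in\mathbb N$, $t_0\in\mathbb R$ and $c_0>0$, not depending on $n$ or $T$, such that for all $n\ge n_0$ and all $T\ge t_0$ $$\mathbb P\big(Z_n\ge T\big)\le c_0\exp\Big(-\frac{T}{c_0^2}\Big).$$ (As $Z_n$ is a supremum over an uncountable family, $\mathbb P$ denotes outer probability where measurability is not known.) -/

import Mathlib

open MeasureTheory ProbabilityTheory Set Filter
open scoped ENNReal

universe u

noncomputable section

namespace FusedDensity

/-- `f` belongs to the class `𝓕` of densities of log-bounded variation on `[a, b]`: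
`f = exp g` on `[a, b]` for a function `g` of bounded variation there, and `∫_a^b f = 1`.
(Values of `f` outside `[a, b]` play no role. The function `g` is `log f`.) -/
structure IsLogBVDensity (a b : ℝ) (f : ℝ → ℝ) : Prop where
  pos : ∀ x ∈ Icc a b, 0 < f x
  bv : BoundedVariationOn (fun x => Real.log (f x)) (Icc a b)
  integral_eq_one : ∫ x in Icc a b, f x = 1

/-- `I(f) = TV(log f)`, the pointwise total variation of `log f` over `[a, b]`. -/
def logTV (a b : ℝ) (f : ℝ → ℝ) : ℝ :=
  (eVariationOn (fun x => Real.log (f x)) (Icc a b)).toReal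

/-- `J(f) = 1 + TV(log f) + TV(log f₀)`. -/
def J (a b : ℝ) (f₀ f : ℝ → ℝ) : ℝ :=
  1 + logTV a b f + logTV a b f₀

/-- The Hellinger distance `h(f, f₀)`, where `h² = ½ ∫_a^b (√f - √f₀)² dx`. -/
def hellinger (a b : ℝ) (f f₀ : ℝ → ℝ) : ℝ :=
  Real.sqrt ((1 / 2) * ∫ x in Icc a b, (Real.sqrt (f x) - Real.sqrt (f₀ x)) ^ 2)

/-- `p_f = ½ log ((f + f₀) / (2 f₀))`. -/
def pFun (f₀ f : ℝ → ℝ) (x : ℝ) : ℝ :=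
  (1 / 2) * Real.log ((f x + f₀ x) / (2 * f₀ x))

/-- The probability measure `P` on `[a, b]` with Lebesgue density `f₀`. -/
def law (a b : ℝ) (f₀ : ℝ → ℝ) : Measure ℝ :=
  (volume.restrict (Icc a b)).withDensity (fun x => ENNReal.ofReal (f₀ x))

/-- `P_n(g)`: the mean of `g` under the empirical measure of the sample `x₁, …, x_n`. -/
def empMean {n : ℕ} (x : Fin n → ℝ) (g : ℝ → ℝ) : ℝ :=
  (1 / (n : ℝ)) * ∑ i, g (x i)

/-- The supremum, over all `f ∈ 𝓕` with `h(f, f₀) ≤ n^{-1/3} J(f)`, of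
`n^{2/3} |(P_n - P)(p_f)| / J(f)`, as an extended nonnegative real. -/
def supDeviation (a b : ℝ) (f₀ : ℝ → ℝ) {n : ℕ} (x : Fin n → ℝ) : ℝ≥0∞ :=
  ⨆ (f : ℝ → ℝ) (_ : IsLogBVDensity a b f)
    (_ : hellinger a b f f₀ ≤ (n : ℝ) ^ (-(1 / 3) : ℝ) * J a b f₀ f),
    ENNReal.ofReal ((n : ℝ) ^ (2 / 3 : ℝ) *
      |empMean x (pFun f₀ f) - ∫ t, pFun f₀ f t ∂(law a b f₀)| / J a b f₀ f)

/-- `X` is a family of independent random variables on `(Ω, μ)`, each with density `f₀`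
on `[a, b]`. -/
structure IsIIDSample {Ω : Type u} [MeasurableSpace Ω] {ι : Type} (μ : Measure Ω)
    (a b : ℝ) (f₀ : ℝ → ℝ) (X : ι → Ω → ℝ) : Prop where
  measurable : ∀ i, Measurable (X i)
  map_eq : ∀ i, μ.map (X i) = law a b f₀
  indep : iIndepFun X μ

/-- `Z_n = O_P(1)`. For a `Z_n` that is not known to be measurable, `μ` of the event is its
outer measure. -/
def IsBigOPOne {Ω : Type u} [MeasurableSpace Ω] (μ : Measure Ω) (Z : ℕ → Ω → ℝ≥0∞) : Prop :=
  ∀ ε : ℝ, 0 < ε → ∃ (K : ℝ) (N : ℕ), ∀ n ≥ N,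
    μ {ω | ENNReal.ofReal K < Z n ω} < ENNReal.ofReal ε

end FusedDensity

end

/-!
After division by `J(f)`, the functions `p_f` with `h(f, f₀) ≤ n^(-1/3) J(f)` become functions `q`
on `[a, b]` of total variation at most `1` (`eVariationOn_pFun_div_J_le`, because
`u ↦ log (1 + exp u)` is Lipschitz) whose `L²` norm is `O(n^(-1/3))` (`integral_sq_pFun_le`,
because `|½ log ((1 + s²) / 2)| ≤ |s - 1|` and `f₀` is bounded away from `0`). So it suffices to
bound `(P_n - P)(q)` by `O(n^(-2/3))`, uniformly over such `q`.

This is done by an explicit chaining along dyadic cells. Let `8 ^ m ≤ n < 8 ^ (m + 1)`, and let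
`q_j` be the function equal on each dyadic cell of level `j` to the average of `q` there. Then `q`
is the sum of `q_m`, the increments `q_{j+1} - q_j` for `m ≤ j < 2 m`, and the remainder
`q - q_{2m}`, and `P_n - P` of each piece is a linear combination of (or is bounded through) the
deviations `(P_n - P)(I)` of cells `I`. The coefficients of the increments are bounded in `ℓ¹` by
the total variation and in `ℓ²` by the `L²` norm of `q`. Bounding a sum by the `ℓ¹` norm alone
would cost a logarithmic factor, from the maximum over all cells of a level. Instead the rescaled
deviations at level `m + i` are truncated at a threshold proportional to `T (i + 1)`: the part
below it is paired with the `ℓ¹` norm, and the excess, which is exponentially rare, is paired with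
the `ℓ²` norm (`abs_sum_mul_le`, `abs_sum_mul_cellDev_le`). The resulting bounds decay
geometrically in `i` and sum to `O(T / 4 ^ m)` (`abs_deviation_le_of_goodSample`).

The event `GoodSample` on which all excesses are small needs only the exponential moments of
centred binomial variables and Markov's inequality; because the thresholds are proportional to
`T`, it fails with probability `O(exp (-T))` (`measure_not_goodSample_le`). The bound in
probability is a consequence of the exponential tail.
-/

namespace FusedDensity

/-! ### Dyadic cells and cell averages -/

/-- The `k`-th endpoint of the division of `[a, b]` into `2 ^ j` intervals of equal length. -/
noncomputable def gridPt (a b : ℝ) (j k : ℕ) : ℝ := a + k * ((b - a) / 2 ^ j)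

/-- The `k`-th dyadic cell of level `j`. Cells are half-open, so that those with `k < 2 ^ j`
partition `(a, b]`. -/
def cell (a b : ℝ) (j k : ℕ) : Set ℝ := Ioc (gridPt a b j k) (gridPt a b j (k + 1))

/-- The Lebesgue average of `q` over the `k`-th dyadic cell of level `j`. -/
noncomputable def cellMean (a b : ℝ) (q : ℝ → ℝ) (j k : ℕ) : ℝ :=
  (gridPt a b j (k + 1) - gridPt a b j k)⁻¹ *
    ∫ x in gridPt a b j k..gridPt a b j (k + 1), q x

/-- The total variation of `q` over the closure of the `k`-th dyadic cell of level `j`. -/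
noncomputable def cellVar (a b : ℝ) (q : ℝ → ℝ) (j k : ℕ) : ℝ :=
  (eVariationOn q (Icc (gridPt a b j k) (gridPt a b j (k + 1)))).toReal

section Dyadic

variable {a b : ℝ} {q : ℝ → ℝ}

lemma gridPt_zero (a b : ℝ) (j : ℕ) : gridPt a b j 0 = a := by simp [gridPt]

lemma gridPt_two_pow (a b : ℝ) (j : ℕ) : gridPt a b j (2 ^ j) = b := by
  simp only [gridPt]; push_cast; field_simp; ring

lemma gridPt_two_mul (a b : ℝ) (j k : ℕ) : gridPt a b (j + 1) (2 * k) = gridPt a b j k := by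
  simp only [gridPt, pow_succ]; push_cast; field_simp

lemma gridPt_succ_sub (a b : ℝ) (j k : ℕ) :
    gridPt a b j (k + 1) - gridPt a b j k = (b - a) / 2 ^ j := by
  simp only [gridPt]; push_cast; ring

lemma gridPt_mono (hab : a ≤ b) (j : ℕ) : Monotone (gridPt a b j) := by
  intro k l hkl
  have : (k : ℝ) ≤ l := by exact_mod_cast hkl
  have h0 : 0 ≤ (b - a) / 2 ^ j := div_nonneg (by linarith) (by positivity)
  simp only [gridPt]
  nlinarith [mul_le_mul_of_nonneg_right this h0]

lemma gridPt_lt_succ (hab : a < b) (j k : ℕ) : gridPt a b j k < gridPt a b j (k + 1) := by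
  have h := gridPt_succ_sub a b j k
  have : 0 < (b - a) / 2 ^ j := div_pos (by linarith) (by positivity)
  linarith

lemma Icc_gridPt_subset (hab : a ≤ b) {j k : ℕ} (hk : k < 2 ^ j) :
    Icc (gridPt a b j k) (gridPt a b j (k + 1)) ⊆ Icc a b := by
  apply Icc_subset_Icc
  · simpa [gridPt_zero] using gridPt_mono hab j (Nat.zero_le k)
  · simpa [gridPt_two_pow] using gridPt_mono hab j (Nat.succ_le_of_lt hk)

lemma cell_subset (hab : a ≤ b) {j k : ℕ} (hk : k < 2 ^ j) : cell a b j k ⊆ Icc a b :=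
  Ioc_subset_Icc_self.trans (Icc_gridPt_subset hab hk)

lemma measurableSet_cell (a b : ℝ) (j k : ℕ) : MeasurableSet (cell a b j k) := measurableSet_Ioc

lemma cell_eq_union (hab : a ≤ b) (j k : ℕ) :
    cell a b j k = cell a b (j + 1) (2 * k) ∪ cell a b (j + 1) (2 * k + 1) := by
  have h1 := gridPt_two_mul a b j k
  have h2 : gridPt a b (j + 1) (2 * k + 1 + 1) = gridPt a b j (k + 1) := by
    rw [← gridPt_two_mul a b j (k + 1), mul_add, mul_one]
  unfold cell
  rw [h1, h2, Ioc_union_Ioc_eq_Ioc]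
  · rw [← h1]; exact gridPt_mono hab _ (by omega)
  · rw [← h2]; exact gridPt_mono hab _ (by omega)

lemma disjoint_cell (hab : a ≤ b) (j : ℕ) {k l : ℕ} (h : k ≠ l) :
    Disjoint (cell a b j k) (cell a b j l) :=
  (gridPt_mono hab j).pairwise_disjoint_on_Ioc_succ h

lemma iUnion_cell (hab : a ≤ b) (j : ℕ) : ⋃ k ∈ Finset.range (2 ^ j), cell a b j k = Ioc a b := by
  have h : ∀ N, ⋃ k ∈ Finset.range N, cell a b j k = Ioc a (gridPt a b j N) := by
    intro N
    induction N with
    | zero => simp [gridPt_zero]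
    | succ N ih =>
      rw [Finset.range_add_one, Finset.set_biUnion_insert, ih, union_comm, cell,
        Ioc_union_Ioc_eq_Ioc]
      · simpa [gridPt_zero] using gridPt_mono hab j (Nat.zero_le N)
      · exact gridPt_mono hab j (Nat.le_succ N)
  rw [h, gridPt_two_pow]

lemma intervalIntegrable_gridPt (hab : a ≤ b) (hq : IntegrableOn q (Icc a b)) {j k : ℕ}
    (hk : k < 2 ^ j) :
    IntervalIntegrable q volume (gridPt a b j k) (gridPt a b j (k + 1)) := by
  rw [intervalIntegrable_iff_integrableOn_Icc_of_le (gridPt_mono hab j (Nat.le_succ k))]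
  exact hq.mono_set (Icc_gridPt_subset hab hk)

/-- An average of values within `v` of `M` is within `v` of `M`. -/
lemma abs_average_sub_le {c d M v : ℝ} (hcd : c < d) (hq : IntervalIntegrable q volume c d)
    (h : ∀ x ∈ Icc c d, |q x - M| ≤ v) : |(d - c)⁻¹ * (∫ x in c..d, q x) - M| ≤ v := by
  have hd : 0 < d - c := sub_pos.2 hcd
  have e : (d - c)⁻¹ * (∫ x in c..d, q x) - M = (d - c)⁻¹ * ∫ x in c..d, (q x - M) := by
    rw [intervalIntegral.integral_sub hq (by simp), intervalIntegral.integral_const, smul_eq_mul]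
    field_simp
  have := intervalIntegral.norm_integral_le_of_norm_le_const (a := c) (b := d)
    (f := fun x => q x - M) (C := v)
    (fun x hx => h x (Ioc_subset_Icc_self (by rwa [uIoc_of_le hcd.le] at hx)))
  rw [Real.norm_eq_abs, abs_of_pos hd] at this
  rw [e, abs_mul, abs_of_pos (inv_pos.2 hd), inv_mul_le_iff₀ hd]
  linarith

lemma abs_sub_cellMean_le (hab : a < b) (hq : IntegrableOn q (Icc a b))
    (hbv : BoundedVariationOn q (Icc a b)) {j k : ℕ} (hk : k < 2 ^ j) {x : ℝ}
    (hx : x ∈ Icc (gridPt a b j k) (gridPt a b j (k + 1))) :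
    |q x - cellMean a b q j k| ≤ cellVar a b q j k := by
  rw [abs_sub_comm]
  refine abs_average_sub_le (gridPt_lt_succ hab j k) (intervalIntegrable_gridPt hab.le hq hk) ?_
  intro y hy
  rw [← Real.dist_eq]
  exact (hbv.mono (Icc_gridPt_subset hab.le hk)).dist_le hy hx

lemma abs_cellMean_succ_sub_le (hab : a < b) (hq : IntegrableOn q (Icc a b))
    (hbv : BoundedVariationOn q (Icc a b)) {j k l : ℕ} (hk : k < 2 ^ j)
    (hl : l = 2 * k ∨ l = 2 * k + 1) :
    |cellMean a b q (j + 1) l - cellMean a b q j k| ≤ cellVar a b q j k := by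
  have hl' : l < 2 ^ (j + 1) := by rw [pow_succ]; omega
  refine abs_average_sub_le (gridPt_lt_succ hab _ l) (intervalIntegrable_gridPt hab.le hq hl') ?_
  intro y hy
  refine abs_sub_cellMean_le hab hq hbv hk (Icc_subset_Icc ?_ ?_ hy)
  · rw [← gridPt_two_mul]; exact gridPt_mono hab.le _ (by omega)
  · rw [← gridPt_two_mul a b j (k + 1)]; exact gridPt_mono hab.le _ (by omega)

lemma cellVar_nonneg (j k : ℕ) : 0 ≤ cellVar a b q j k := ENNReal.toReal_nonneg

lemma sum_cellVar_eq (hab : a ≤ b) (hbv : BoundedVariationOn q (Icc a b)) (j : ℕ) :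
    ∑ k ∈ Finset.range (2 ^ j), cellVar a b q j k = (eVariationOn q (Icc a b)).toReal := by
  have h := eVariationOn.sum' q (gridPt_mono hab j) (n := 2 ^ j)
  rw [gridPt_zero, gridPt_two_pow] at h
  rw [← h, ENNReal.toReal_sum]
  · rfl
  · intro k hk
    exact hbv.mono (Icc_gridPt_subset hab (Finset.mem_range.1 hk))

lemma sq_cellMean_le (hab : a < b) (hq : IntegrableOn q (Icc a b))
    (hq2 : IntegrableOn (fun x => q x ^ 2) (Icc a b)) {j k : ℕ} (hk : k < 2 ^ j) :
    cellMean a b q j k ^ 2 ≤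
      2 ^ j / (b - a) * ∫ x in gridPt a b j k..gridPt a b j (k + 1), q x ^ 2 := by
  have hba : 0 < b - a := sub_pos.2 hab
  set M := cellMean a b q j k with hM
  have i1 := intervalIntegrable_gridPt hab.le hq hk
  have i2 := intervalIntegrable_gridPt hab.le hq2 hk
  have hI : ∫ x in gridPt a b j k..gridPt a b j (k + 1), q x = (b - a) / 2 ^ j * M := by
    rw [hM, cellMean, gridPt_succ_sub]; field_simp
  have h0 : 0 ≤ ∫ x in gridPt a b j k..gridPt a b j (k + 1), (q x - M) ^ 2 :=
    intervalIntegral.integral_nonneg (gridPt_lt_succ hab j k).le (fun x _ => sq_nonneg _)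
  have e : ∫ x in gridPt a b j k..gridPt a b j (k + 1), (q x - M) ^ 2 =
      (∫ x in gridPt a b j k..gridPt a b j (k + 1), q x ^ 2) - (b - a) / 2 ^ j * M ^ 2 := by
    have : (fun x => (q x - M) ^ 2) = fun x => (q x ^ 2 - 2 * M * q x) + M ^ 2 := by
      funext x; ring
    rw [this, intervalIntegral.integral_add (i2.sub (i1.const_mul _)) (by simp),
      intervalIntegral.integral_sub i2 (i1.const_mul _), intervalIntegral.integral_const_mul, hI,
      intervalIntegral.integral_const, gridPt_succ_sub, smul_eq_mul]
    ring
  rw [e] at h0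
  have : M ^ 2 = 2 ^ j / (b - a) * ((b - a) / 2 ^ j * M ^ 2) := by field_simp
  rw [this]
  exact mul_le_mul_of_nonneg_left (by linarith) (by positivity)

lemma sum_sq_cellMean_le (hab : a < b) (hq : IntegrableOn q (Icc a b))
    (hq2 : IntegrableOn (fun x => q x ^ 2) (Icc a b)) (j : ℕ) :
    ∑ k ∈ Finset.range (2 ^ j), cellMean a b q j k ^ 2 ≤
      2 ^ j / (b - a) * ∫ x in Icc a b, q x ^ 2 := by
  refine (Finset.sum_le_sum fun k hk =>
    sq_cellMean_le hab hq hq2 (Finset.mem_range.1 hk)).trans_eq ?_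
  rw [← Finset.mul_sum, intervalIntegral.sum_integral_adjacent_intervals (a := gridPt a b j)
    (fun k hk => intervalIntegrable_gridPt hab.le hq2 hk), gridPt_zero, gridPt_two_pow,
    intervalIntegral.integral_of_le hab.le, integral_Icc_eq_integral_Ioc]

/-! ### Multiscale decomposition -/

lemma sum_range_two_mul (F : ℕ → ℝ) (N : ℕ) :
    ∑ k ∈ Finset.range (2 * N), F k = ∑ k ∈ Finset.range N, (F (2 * k) + F (2 * k + 1)) := by
  induction N with
  | zero => simp
  | succ N ih =>
    rw [mul_add, mul_one, Finset.sum_range_succ, Finset.sum_range_succ, ih, Finset.sum_range_succ]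
    ring

/-- Summation over scales: if `d` is additive under dyadic refinement, the pairing of `M` and `d`
at level `m + r` is that at level `m` plus the contributions of the increments of `M`. -/
lemma sum_mul_eq_sum_increments (M d : ℕ → ℕ → ℝ)
    (hd : ∀ j k, d j k = d (j + 1) (2 * k) + d (j + 1) (2 * k + 1)) (m r : ℕ) :
    ∑ k ∈ Finset.range (2 ^ (m + r)), M (m + r) k * d (m + r) k =
      ∑ k ∈ Finset.range (2 ^ m), M m k * d m k +
      ∑ i ∈ Finset.range r, ∑ k ∈ Finset.range (2 ^ (m + i + 1)),
        (M (m + i + 1) k - M (m + i) (k / 2)) * d (m + i + 1) k := by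
  induction r with
  | zero => simp
  | succ r ih =>
    rw [Finset.sum_range_succ, ← add_assoc m r 1, ← add_assoc (Finset.sum _ _), ← ih]
    simp_rw [sub_mul, Finset.sum_sub_distrib]
    have : ∑ k ∈ Finset.range (2 ^ (m + r + 1)), M (m + r) (k / 2) * d (m + r + 1) k =
        ∑ k ∈ Finset.range (2 ^ (m + r)), M (m + r) k * d (m + r) k := by
      rw [pow_succ, mul_comm, sum_range_two_mul]
      refine Finset.sum_congr rfl fun k _ => ?_
      have h1 : 2 * k / 2 = k := by omega
      have h2 : (2 * k + 1) / 2 = k := by omega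
      rw [h1, h2, hd (m + r) k, mul_add]
    rw [this]; ring

/-- Truncating `|g|` at height `t` and using the `ℓ¹` norm of `c` below `t`, the `ℓ²` norm
above. -/
lemma abs_sum_mul_le {N : ℕ} {c g : ℕ → ℝ} {L B α t : ℝ} (hα : 0 < α) (ht : 0 ≤ t)
    (hL : ∑ k ∈ Finset.range N, |c k| ≤ L) (hB : ∑ k ∈ Finset.range N, c k ^ 2 ≤ B / α)
    (hg : ∑ k ∈ Finset.range N, (max (|g k| - t) 0) ^ 2 ≤ α) :
    |∑ k ∈ Finset.range N, c k * g k| ≤ L * t + B + 1 := by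
  have hpt : ∀ k, |c k * g k| ≤ |c k| * t + (α * c k ^ 2 + α⁻¹ * (max (|g k| - t) 0) ^ 2) := by
    intro k
    have h1 : |g k| ≤ t + max (|g k| - t) 0 := by linarith [le_max_left (|g k| - t) 0]
    set w := max (|g k| - t) 0
    have h2 : |c k| * w ≤ α * c k ^ 2 + α⁻¹ * w ^ 2 := by
      have h3 : α * |c k| ^ 2 + α⁻¹ * w ^ 2 - |c k| * w =
          α⁻¹ * ((α * |c k| - w / 2) ^ 2 + 3 / 4 * w ^ 2) := by field_simp; ring
      have h4 : 0 ≤ α⁻¹ * ((α * |c k| - w / 2) ^ 2 + 3 / 4 * w ^ 2) := by positivity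
      rw [sq_abs] at h3; linarith
    rw [abs_mul]
    nlinarith [mul_le_mul_of_nonneg_left h1 (abs_nonneg (c k))]
  refine (Finset.abs_sum_le_sum_abs _ _).trans ((Finset.sum_le_sum fun k _ => hpt k).trans ?_)
  rw [Finset.sum_add_distrib, Finset.sum_add_distrib, ← Finset.sum_mul, ← Finset.mul_sum,
    ← Finset.mul_sum]
  have h1 := mul_le_mul_of_nonneg_right hL ht
  have h2 := mul_le_mul_of_nonneg_left hB hα.le
  have h3 := mul_le_mul_of_nonneg_left hg (inv_pos.2 hα).le
  rw [mul_div_cancel₀ _ hα.ne'] at h2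
  rw [inv_mul_cancel₀ hα.ne'] at h3
  linarith

/-- Partial sums of `∑ (i + 1) (3/4) ^ i = 16`. -/
lemma sum_succ_mul_pow_le (r : ℕ) :
    ∑ i ∈ Finset.range r, ((i : ℝ) + 1) * (3 / 4) ^ i ≤ 16 := by
  have h : ∀ r : ℕ, ∑ i ∈ Finset.range r, ((i : ℝ) + 1) * (3 / 4) ^ i =
      16 - (4 * r + 16) * (3 / 4) ^ r := by
    intro r
    induction r with
    | zero => simp
    | succ r ih => rw [Finset.sum_range_succ, ih]; push_cast; ring
  rw [h]
  have : (0 : ℝ) ≤ (4 * r + 16) * (3 / 4) ^ r := by positivity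
  linarith

lemma succ_mul_pow_le (r : ℕ) : ((r : ℝ) + 1) * (3 / 4) ^ r ≤ 16 := by
  refine le_trans ?_ (sum_succ_mul_pow_le (r + 1))
  exact Finset.single_le_sum (f := fun i : ℕ => ((i : ℝ) + 1) * (3 / 4) ^ i)
    (fun i _ => by positivity) (Finset.self_mem_range_succ r)

end Dyadic

/-! ### The empirical process on a ball of functions of bounded variation -/

/-- The deviation `(P_n - P)(I)` of the empirical measure from `P` on the `k`-th dyadic cell `I`
of level `j`. -/
noncomputable def cellDev (a b : ℝ) (P : Measure ℝ) {n : ℕ} (x : Fin n → ℝ) (j k : ℕ) : ℝ :=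
  empMean x ((cell a b j k).indicator 1) - P.real (cell a b j k)

/-- The event on which the empirical process is controlled at the levels `m, …, 2 m`: at level
`m + i`, the rescaled cell deviations exceed the threshold `3 T (i + 1)` only by amounts whose
sum of squares is at most `2 ^ m / 2 ^ i`. For `n` of order `8 ^ m` the deviation of a cell of
level `m + i`, multiplied by `n`, has standard deviation of order `2 ^ m / (√2) ^ i`. The
normalization by `2 ^ m / (4 / 3) ^ i` instead, with `4 / 3 < √2`, keeps the exponential moments
of the rescaled deviations bounded and still decays geometrically in `i`, which pays for the
growth of the thresholds. -/
def GoodSample (a b : ℝ) (P : Measure ℝ) {n : ℕ} (x : Fin n → ℝ) (m : ℕ) (T : ℝ) : Prop :=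
  (∀ i, x i ∈ Ioc a b) ∧ ∀ i ≤ m, ∑ k ∈ Finset.range (2 ^ (m + i)),
    (max (|(4 / 3) ^ i / 2 ^ m * (n * cellDev a b P x (m + i) k)| - 3 * T * (i + 1)) 0) ^ 2 ≤
      2 ^ m / 2 ^ i

section Chaining

variable {a b : ℝ} {q : ℝ → ℝ} {P : Measure ℝ} {n : ℕ} {x : Fin n → ℝ}

lemma empMean_add (g h : ℝ → ℝ) : empMean x (g + h) = empMean x g + empMean x h := by
  simp [empMean, Finset.sum_add_distrib, mul_add]

lemma cellDev_succ [IsFiniteMeasure P] (hab : a ≤ b) (j k : ℕ) :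
    cellDev a b P x j k =
      cellDev a b P x (j + 1) (2 * k) + cellDev a b P x (j + 1) (2 * k + 1) := by
  have hd : Disjoint (cell a b (j + 1) (2 * k)) (cell a b (j + 1) (2 * k + 1)) :=
    disjoint_cell hab _ (by omega)
  simp only [cellDev]
  rw [cell_eq_union hab, measureReal_union hd (measurableSet_cell _ _ _ _),
    indicator_union_of_disjoint hd]
  have := empMean_add (x := x) ((cell a b (j + 1) (2 * k)).indicator (1 : ℝ → ℝ))
    ((cell a b (j + 1) (2 * k + 1)).indicator 1)
  simp only [Pi.add_def] at this
  rw [this]; ring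

lemma exists_sum_mul_indicator_eq (hab : a ≤ b) (j : ℕ) {y : ℝ} (hy : y ∈ Ioc a b) :
    ∃ k < 2 ^ j, y ∈ cell a b j k ∧ ∀ c : ℕ → ℝ,
      ∑ l ∈ Finset.range (2 ^ j), c l * (cell a b j l).indicator 1 y = c k := by
  rw [← iUnion_cell hab j] at hy
  simp only [mem_iUnion, Finset.mem_range] at hy
  obtain ⟨k, hk, hyk⟩ := hy
  refine ⟨k, hk, hyk, fun c => ?_⟩
  rw [Finset.sum_eq_single_of_mem k (Finset.mem_range.2 hk)]
  · simp [hyk]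
  · intro l _ hl
    have : y ∉ cell a b j l := fun h => (disjoint_cell hab j hl).le_bot ⟨h, hyk⟩
    simp [this]

/-- Replacing `q` by its cell averages changes `(P_n - P)(q)` by at most the oscillation of `q`
in each cell, weighted by the `P_n`- and `P`-masses of the cell. -/
lemma abs_deviation_sub_sum_le [IsProbabilityMeasure P] (hab : a < b)
    (hq : IntegrableOn q (Icc a b)) (hbv : BoundedVariationOn q (Icc a b))
    (hqP : Integrable q P) (hP : ∀ᵐ y ∂P, y ∈ Ioc a b) (hx : ∀ i, x i ∈ Ioc a b) (j : ℕ) :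
    |empMean x q - ∫ y, q y ∂P -
        ∑ k ∈ Finset.range (2 ^ j), cellMean a b q j k * cellDev a b P x j k| ≤
      ∑ k ∈ Finset.range (2 ^ j), cellVar a b q j k *
        (cellDev a b P x j k + 2 * P.real (cell a b j k)) := by
  set s := Finset.range (2 ^ j)
  set I : ℕ → ℝ → ℝ := fun k => (cell a b j k).indicator 1 with hI
  set r : ℝ → ℝ := fun y => q y - ∑ k ∈ s, cellMean a b q j k * I k y with hr
  set w : ℝ → ℝ := fun y => ∑ k ∈ s, cellVar a b q j k * I k y with hw
  have hrw : ∀ y ∈ Ioc a b, |r y| ≤ w y := by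
    intro y hy
    obtain ⟨k, hk, hyk, h⟩ := exists_sum_mul_indicator_eq hab.le j hy
    simp only [hr, hw, hI, s, h]
    exact abs_sub_cellMean_le hab hq hbv hk (Ioc_subset_Icc_self hyk)
  have hIi : ∀ (c : ℕ → ℝ), ∀ k ∈ s, Integrable (fun y => c k * I k y) P := fun c k _ =>
    ((integrable_const (1 : ℝ)).indicator (measurableSet_cell a b j k)).const_mul _
  have hsum : ∀ c : ℕ → ℝ, ∫ y, ∑ k ∈ s, c k * I k y ∂P =
      ∑ k ∈ s, c k * P.real (cell a b j k) := by
    intro c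
    rw [integral_finsetSum _ (hIi c)]
    refine Finset.sum_congr rfl fun k _ => ?_
    rw [integral_const_mul, hI, integral_indicator_one (measurableSet_cell a b j k)]
  have hemp : ∀ c : ℕ → ℝ, empMean x (fun y => ∑ k ∈ s, c k * I k y) =
      ∑ k ∈ s, c k * empMean x (I k) := by
    intro c
    simp only [empMean]
    rw [Finset.sum_comm, Finset.mul_sum]
    refine Finset.sum_congr rfl fun k _ => ?_
    rw [← Finset.mul_sum]; ring
  have hPr : ∫ y, r y ∂P = ∫ y, q y ∂P - ∑ k ∈ s, cellMean a b q j k * P.real (cell a b j k) := by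
    rw [← hsum, hr, integral_sub hqP (integrable_finsetSum _ (hIi _))]
  have her : empMean x r = empMean x q - ∑ k ∈ s, cellMean a b q j k * empMean x (I k) := by
    rw [← hemp]; simp [empMean, hr, mul_sub]
  have h1 : |empMean x r| ≤ empMean x w := by
    simp only [empMean]
    rw [abs_mul, abs_of_nonneg (by positivity : (0 : ℝ) ≤ 1 / n)]
    exact mul_le_mul_of_nonneg_left ((Finset.abs_sum_le_sum_abs _ _).trans
      (Finset.sum_le_sum fun i _ => hrw _ (hx i))) (by positivity)
  have h2 : |∫ y, r y ∂P| ≤ ∫ y, w y ∂P := by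
    refine abs_integral_le_integral_abs.trans (integral_mono_ae ?_
      (integrable_finsetSum _ (hIi _)) ?_)
    · exact (hqP.sub (integrable_finsetSum _ (hIi _))).abs
    · filter_upwards [hP] with y hy using hrw y hy
  have e1 : empMean x q - ∫ y, q y ∂P - ∑ k ∈ s, cellMean a b q j k * cellDev a b P x j k =
      empMean x r - ∫ y, r y ∂P := by
    rw [hPr, her]
    simp only [cellDev, mul_sub, Finset.sum_sub_distrib]
    ring
  have e2 : ∑ k ∈ s, cellVar a b q j k * (cellDev a b P x j k + 2 * P.real (cell a b j k)) =
      empMean x w + ∫ y, w y ∂P := by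
    rw [hsum, hemp, ← Finset.sum_add_distrib]
    refine Finset.sum_congr rfl fun k _ => ?_
    simp only [cellDev]; ring
  rw [e1, e2]
  exact (abs_sub _ _).trans (add_le_add h1 h2)

/-- The contribution of level `m + i` to the empirical process on the good event, for
coefficients with the `ℓ¹` and `ℓ²` bounds available there. -/
lemma abs_sum_mul_cellDev_le {m i : ℕ} {T L B : ℝ} {c : ℕ → ℝ} (hn : (8 : ℝ) ^ m ≤ n)
    (hT : 1 ≤ T) (hx : GoodSample a b P x m T) (hi : i ≤ m) (hL0 : 0 ≤ L) (hB0 : 0 ≤ B)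
    (hL : ∑ k ∈ Finset.range (2 ^ (m + i)), |c k| ≤ L)
    (hB : ∑ k ∈ Finset.range (2 ^ (m + i)), c k ^ 2 ≤ B / (2 ^ m / 2 ^ i)) :
    |∑ k ∈ Finset.range (2 ^ (m + i)), c k * cellDev a b P x (m + i) k| ≤
      (3 * L + B + 1) * T / 4 ^ m * (((i : ℝ) + 1) * (3 / 4) ^ i) := by
  have hn0 : (0 : ℝ) < n := lt_of_lt_of_le (by positivity) hn
  have hi0 : (0 : ℝ) ≤ i := Nat.cast_nonneg i
  have key := abs_sum_mul_le (by positivity) (by positivity) hL hB (hx.2 i hi)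
  set S := ∑ k ∈ Finset.range (2 ^ (m + i)), c k * cellDev a b P x (m + i) k with hS
  have e : ∑ k ∈ Finset.range (2 ^ (m + i)),
      c k * ((4 / 3) ^ i / 2 ^ m * (n * cellDev a b P x (m + i) k)) =
      (4 / 3) ^ i / 2 ^ m * n * S := by
    rw [hS, Finset.mul_sum]; exact Finset.sum_congr rfl fun k _ => by ring
  rw [e, abs_mul, abs_of_pos (by positivity)] at key
  have h2 : L * (3 * T * (i + 1)) + B + 1 ≤ (3 * L + B + 1) * T * (i + 1) := by
    have : 1 ≤ T * (i + 1) := by nlinarith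
    nlinarith [mul_le_mul_of_nonneg_left this hB0]
  have h3 : (4 / 3 : ℝ) ^ i * 4 ^ m ≤ (4 / 3) ^ i / 2 ^ m * n := by
    rw [div_mul_eq_mul_div, le_div_iff₀ (by positivity), mul_assoc, ← mul_pow]
    norm_num
    exact hn
  have h4 : (4 / 3 : ℝ) ^ i * 4 ^ m * |S| ≤ (3 * L + B + 1) * T * (i + 1) :=
    (mul_le_mul_of_nonneg_right h3 (abs_nonneg S)).trans (key.trans h2)
  have h5 : (3 / 4 : ℝ) ^ i = ((4 / 3) ^ i)⁻¹ := by rw [← inv_pow]; norm_num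
  rw [h5]
  have h6 : (3 * L + B + 1) * T / 4 ^ m * (((i : ℝ) + 1) * ((4 / 3) ^ i)⁻¹) =
      (3 * L + B + 1) * T * (i + 1) / ((4 / 3) ^ i * 4 ^ m) := by field_simp
  rw [h6, le_div_iff₀ (by positivity)]
  linarith

/-- On the good event, the empirical process is of order `T / 4 ^ m`, that is `T n^(-2/3)`,
uniformly over functions of variation at most `1` and `L²` norm of order `2 ^ (-m)`. -/
theorem abs_deviation_le_of_goodSample [IsProbabilityMeasure P] (hab : a < b) {m : ℕ}
    {T D β : ℝ} (hn : (8 : ℝ) ^ m ≤ n) (hT : 1 ≤ T) (hx : GoodSample a b P x m T)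
    (hP : ∀ᵐ y ∂P, y ∈ Ioc a b)
    (hPD : ∀ j k, k < 2 ^ j → P.real (cell a b j k) ≤ D / 2 ^ j)
    (hq : IntegrableOn q (Icc a b)) (hq2 : IntegrableOn (fun x => q x ^ 2) (Icc a b))
    (hbv : BoundedVariationOn q (Icc a b)) (hV : (eVariationOn q (Icc a b)).toReal ≤ 1)
    (hqP : Integrable q P) (hβ : ∫ x in Icc a b, q x ^ 2 ≤ β * (b - a) / 4 ^ m) :
    |empMean x q - ∫ y, q y ∂P| ≤ (112 * β + 192 + 2 * D) * T / 4 ^ m := by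
  have hba : 0 < b - a := sub_pos.2 hab
  have hβ0 : 0 ≤ β := by
    have h : 0 ≤ β * (b - a) / 4 ^ m :=
      (integral_nonneg (fun x => sq_nonneg (q x))).trans hβ
    have h' : 0 ≤ β * (b - a) := by
      by_contra hc
      exact absurd h (not_le.2 (div_neg_of_neg_of_pos (not_le.1 hc) (by positivity)))
    exact nonneg_of_mul_nonneg_left h' hba
  have hD0 : 0 ≤ D := by simpa using measureReal_nonneg.trans (hPD 0 0 (by simp))
  have hTm : (0 : ℝ) ≤ T / 4 ^ m := by positivity
  have h4 : (4 : ℝ) ^ m = 2 ^ m * 2 ^ m := by rw [← mul_pow]; norm_num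
  have hM2 : ∀ i, ∑ k ∈ Finset.range (2 ^ (m + i)), cellMean a b q (m + i) k ^ 2 ≤
      β * 2 ^ i / 2 ^ m := by
    intro i
    refine (sum_sq_cellMean_le hab hq hq2 (m + i)).trans
      ((mul_le_mul_of_nonneg_left hβ (by positivity)).trans_eq ?_)
    rw [h4, pow_add]; field_simp
  have hv : ∀ j, ∑ k ∈ Finset.range (2 ^ j), cellVar a b q j k ≤ 1 := fun j =>
    (sum_cellVar_eq hab.le hbv j).trans_le hV
  set E : ℝ := (7 * β + 7) * T / 4 ^ m with hE
  have hE' : E = (3 * (β + 2) + 4 * β + 1) * T / 4 ^ m := by rw [hE]; ring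
  -- the coarsest level: the `L²` bound controls both norms of the coefficients
  have hbase : |∑ k ∈ Finset.range (2 ^ m), cellMean a b q m k * cellDev a b P x m k| ≤
      E * (((0 : ℕ) + 1 : ℝ) * (3 / 4) ^ 0) := by
    have hM := hM2 0
    simp only [add_zero, pow_zero, mul_one] at hM
    rw [hE']
    -- `L = β + 2` and `B = 4 β` serve at every level
    refine abs_sum_mul_cellDev_le (i := 0) hn hT hx (Nat.zero_le m) (by positivity)
      (by positivity) ?_ ?_
    · have hpt : ∀ k, |cellMean a b q m k| ≤ 2 ^ m * cellMean a b q m k ^ 2 + (2 ^ m)⁻¹ := by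
        intro k
        have h3 : 2 ^ m * |cellMean a b q m k| ^ 2 + (2 ^ m)⁻¹ - |cellMean a b q m k| =
            (2 ^ m)⁻¹ * ((2 ^ m * |cellMean a b q m k| - 1 / 2) ^ 2 + 3 / 4) := by
          field_simp; ring
        have : 0 ≤ (2 ^ m)⁻¹ * ((2 ^ m * |cellMean a b q m k| - 1 / 2) ^ 2 + 3 / 4) := by
          positivity
        rw [sq_abs] at h3; linarith
      refine (Finset.sum_le_sum fun k _ => hpt k).trans ?_
      rw [Finset.sum_add_distrib, ← Finset.mul_sum]
      simp only [add_zero, Finset.sum_const, Finset.card_range, nsmul_eq_mul, Nat.cast_pow,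
        Nat.cast_ofNat]
      rw [mul_inv_cancel₀ (by positivity)]
      have := mul_le_mul_of_nonneg_left hM (by positivity : (0 : ℝ) ≤ 2 ^ m)
      rw [mul_div_cancel₀ _ (by positivity)] at this
      linarith
    · simp only [add_zero, pow_zero, div_one]
      refine hM.trans ?_
      gcongr; linarith
  -- the increments between consecutive levels: the variation gives an `ℓ¹` bound
  have hinc : ∀ i < m, |∑ k ∈ Finset.range (2 ^ (m + i + 1)),
      (cellMean a b q (m + i + 1) k - cellMean a b q (m + i) (k / 2)) *
        cellDev a b P x (m + i + 1) k| ≤ E * (((i + 1 : ℕ) + 1 : ℝ) * (3 / 4) ^ (i + 1)) := by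
    intro i hi
    rw [hE']
    have hdiv1 : ∀ k : ℕ, 2 * k / 2 = k := fun k => by omega
    have hdiv2 : ∀ k : ℕ, (2 * k + 1) / 2 = k := fun k => by omega
    refine abs_sum_mul_cellDev_le (i := i + 1) hn hT hx hi (by positivity) (by positivity) ?_ ?_
    · rw [← add_assoc, pow_succ, mul_comm, sum_range_two_mul]
      have : ∀ k ∈ Finset.range (2 ^ (m + i)),
          |cellMean a b q (m + i + 1) (2 * k) - cellMean a b q (m + i) (2 * k / 2)| +
          |cellMean a b q (m + i + 1) (2 * k + 1) - cellMean a b q (m + i) ((2 * k + 1) / 2)| ≤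
          2 * cellVar a b q (m + i) k := by
        intro k hk
        rw [hdiv1, hdiv2, two_mul (cellVar a b q (m + i) k)]
        have hk' := Finset.mem_range.1 hk
        exact add_le_add (abs_cellMean_succ_sub_le hab hq hbv hk' (Or.inl rfl))
          (abs_cellMean_succ_sub_le hab hq hbv hk' (Or.inr rfl))
      refine (Finset.sum_le_sum this).trans ?_
      rw [← Finset.mul_sum]
      linarith [hv (m + i)]
    · have h1 := hM2 (i + 1)
      have h2 := hM2 i
      have h3 : ∑ k ∈ Finset.range (2 ^ (m + i + 1)), cellMean a b q (m + i) (k / 2) ^ 2 =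
          2 * ∑ k ∈ Finset.range (2 ^ (m + i)), cellMean a b q (m + i) k ^ 2 := by
        rw [pow_succ, mul_comm, sum_range_two_mul, Finset.mul_sum]
        exact Finset.sum_congr rfl fun k _ => by rw [hdiv1, hdiv2]; ring
      have h4 : ∑ k ∈ Finset.range (2 ^ (m + i + 1)),
          (cellMean a b q (m + i + 1) k - cellMean a b q (m + i) (k / 2)) ^ 2 ≤
          ∑ k ∈ Finset.range (2 ^ (m + i + 1)), (2 * cellMean a b q (m + i + 1) k ^ 2 +
            2 * cellMean a b q (m + i) (k / 2) ^ 2) :=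
        Finset.sum_le_sum fun k _ => by
          nlinarith [sq_nonneg (cellMean a b q (m + i + 1) k + cellMean a b q (m + i) (k / 2))]
      rw [Finset.sum_add_distrib, ← Finset.mul_sum, ← Finset.mul_sum, h3] at h4
      refine h4.trans ?_
      have h5 : 4 * β / (2 ^ m / 2 ^ (i + 1)) =
          2 * (β * 2 ^ (i + 1) / 2 ^ m) + 2 * (2 * (β * 2 ^ i / 2 ^ m)) := by
        rw [pow_succ]; field_simp; ring
      rw [h5]
      simp only [← add_assoc] at h1
      linarith
  -- the remainder at the finest level
  have hres := abs_deviation_sub_sum_le (P := P) hab hq hbv hqP hP hx.1 (m + m)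
  have hres' : ∑ k ∈ Finset.range (2 ^ (m + m)), cellVar a b q (m + m) k *
      (cellDev a b P x (m + m) k + 2 * P.real (cell a b (m + m) k)) ≤
      (80 + 2 * D) * (T / 4 ^ m) := by
    simp_rw [mul_add, Finset.sum_add_distrib]
    have h1 : ∑ k ∈ Finset.range (2 ^ (m + m)), cellVar a b q (m + m) k *
        cellDev a b P x (m + m) k ≤ 80 * (T / 4 ^ m) := by
      refine (le_abs_self _).trans ((abs_sum_mul_cellDev_le (L := 1) (B := 1) hn hT hx le_rfl
        zero_le_one zero_le_one ?_ ?_).trans ?_)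
      · simp_rw [abs_of_nonneg (cellVar_nonneg _ _)]; exact hv _
      · rw [div_self (by positivity), div_one]
        refine (Finset.sum_sq_le_sq_sum_of_nonneg fun k _ => cellVar_nonneg _ _).trans ?_
        exact pow_le_one₀ (Finset.sum_nonneg fun k _ => cellVar_nonneg _ _) (hv _)
      · have := mul_le_mul_of_nonneg_left (succ_mul_pow_le m) hTm
        calc _ = 5 * (T / 4 ^ m * (((m : ℝ) + 1) * (3 / 4) ^ m)) := by ring
          _ ≤ _ := by linarith
    have h2 : ∑ k ∈ Finset.range (2 ^ (m + m)), cellVar a b q (m + m) k *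
        (2 * P.real (cell a b (m + m) k)) ≤ 2 * D * (T / 4 ^ m) := by
      have h3 : ∀ k ∈ Finset.range (2 ^ (m + m)), cellVar a b q (m + m) k *
          (2 * P.real (cell a b (m + m) k)) ≤ cellVar a b q (m + m) k * (2 * (D / 2 ^ (m + m))) :=
        fun k hk => mul_le_mul_of_nonneg_left
          (by linarith [hPD (m + m) k (Finset.mem_range.1 hk)]) (cellVar_nonneg _ _)
      refine (Finset.sum_le_sum h3).trans ?_
      have h2m : (2 : ℝ) ^ (m + m) = 4 ^ m := by rw [pow_add, h4]
      rw [← Finset.sum_mul, h2m]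
      have h5 : D / 4 ^ m ≤ D * (T / 4 ^ m) := by
        rw [← mul_div_assoc]; gcongr; nlinarith
      have h6 : 0 ≤ 2 * (D / 4 ^ m) := by positivity
      nlinarith [mul_le_mul_of_nonneg_right (hv (m + m)) h6]
    linarith
  have htel := sum_mul_eq_sum_increments (cellMean a b q) (cellDev a b P x)
    (fun j k => cellDev_succ hab.le j k) m m
  have hmain : |∑ k ∈ Finset.range (2 ^ (m + m)), cellMean a b q (m + m) k *
      cellDev a b P x (m + m) k| ≤ E * 16 := by
    rw [htel]
    refine (abs_add_le _ _).trans ((add_le_add hbase ((Finset.abs_sum_le_sum_abs _ _).trans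
      (Finset.sum_le_sum fun i hi => hinc i (Finset.mem_range.1 hi)))).trans ?_)
    rw [add_comm, ← Finset.sum_range_succ'
      (fun i : ℕ => E * (((i : ℕ) + 1 : ℝ) * (3 / 4) ^ i)) m, ← Finset.mul_sum]
    exact mul_le_mul_of_nonneg_left (sum_succ_mul_pow_le _) (by positivity)
  have htri := abs_add_le (empMean x q - ∫ y, q y ∂P - ∑ k ∈ Finset.range (2 ^ (m + m)),
    cellMean a b q (m + m) k * cellDev a b P x (m + m) k)
    (∑ k ∈ Finset.range (2 ^ (m + m)), cellMean a b q (m + m) k * cellDev a b P x (m + m) k)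
  rw [sub_add_cancel] at htri
  calc _ ≤ (80 + 2 * D) * (T / 4 ^ m) + E * 16 := by linarith
    _ = _ := by rw [hE]; ring

end Chaining

/-! ### The good event has high probability -/

/-- Bernstein's bound on the moment generating function of a centred Bernoulli variable. -/
lemma bernoulli_mgf_le {p s : ℝ} (hp0 : 0 ≤ p) (hp1 : p ≤ 1) (hs : |s| ≤ 1) :
    p * Real.exp (s * (1 - p)) + (1 - p) * Real.exp (s * -p) ≤ Real.exp (s ^ 2 * p) := by
  have hq0 : 0 ≤ 1 - p := by linarith
  have h1 : Real.exp (s * (1 - p)) ≤ 1 + s * (1 - p) + (s * (1 - p)) ^ 2 := by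
    have := Real.abs_exp_sub_one_sub_id_le (x := s * (1 - p))
      (by rw [abs_mul, abs_of_nonneg hq0]; nlinarith [abs_nonneg s])
    linarith [le_abs_self (Real.exp (s * (1 - p)) - 1 - s * (1 - p))]
  have h2 : Real.exp (s * -p) ≤ 1 + s * -p + (s * -p) ^ 2 := by
    have := Real.abs_exp_sub_one_sub_id_le (x := s * -p)
      (by rw [abs_mul, abs_neg, abs_of_nonneg hp0]; nlinarith [abs_nonneg s])
    linarith [le_abs_self (Real.exp (s * -p) - 1 - s * -p)]
  have h3 := mul_le_mul_of_nonneg_left h1 hp0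
  have h4 := mul_le_mul_of_nonneg_left h2 hq0
  have h5 : 0 ≤ s ^ 2 * p ^ 2 := by positivity
  have h6 := Real.add_one_le_exp (s ^ 2 * p)
  nlinarith

lemma sq_max_zero_le (y : ℝ) : (max y 0) ^ 2 ≤ 2 * Real.exp y := by
  rcases le_total y 0 with h | h
  · rw [max_eq_right h]; nlinarith [Real.exp_pos y]
  · rw [max_eq_left h]
    have := Real.quadratic_le_exp_of_nonneg h
    linarith

section Moments

variable {Ω : Type u} [MeasurableSpace Ω] {μ : Measure Ω}
  {P : Measure ℝ} {a b : ℝ} {n : ℕ} {X : Fin n → Ω → ℝ}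

lemma measurable_cellDev (hX : ∀ i, Measurable (X i)) (j k : ℕ) :
    Measurable fun ω => cellDev a b P (fun i => X i ω) j k := by
  unfold cellDev empMean
  refine (measurable_const.mul (Finset.measurable_sum _ fun i _ => ?_)).sub measurable_const
  exact (measurable_one.indicator (measurableSet_cell a b j k)).comp (hX i)

lemma natCast_mul_cellDev (x : Fin n → ℝ) (j k : ℕ) :
    n * cellDev a b P x j k =
      ∑ i, ((cell a b j k).indicator 1 (x i) - P.real (cell a b j k)) := by
  rcases Nat.eq_zero_or_pos n with h | h
  · subst h; simp
  · have : (n : ℝ) ≠ 0 := by positivity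
    simp only [cellDev, empMean, Finset.sum_sub_distrib, Finset.sum_const, Finset.card_univ,
      Fintype.card_fin, nsmul_eq_mul]
    field_simp

variable [IsProbabilityMeasure μ] [IsProbabilityMeasure P]

lemma mgf_indicator_sub_le {A : Set ℝ} (hA : MeasurableSet A) {Y : Ω → ℝ} (hY : Measurable Y)
    (hmap : μ.map Y = P) {s : ℝ} (hs : |s| ≤ 1) :
    mgf (fun ω => A.indicator 1 (Y ω) - P.real A) μ s ≤ Real.exp (s ^ 2 * P.real A) := by
  refine le_trans (le_of_eq ?_) (bernoulli_mgf_le measureReal_nonneg measureReal_le_one hs)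
  set p := P.real A
  have hi : Integrable (fun ω => A.indicator (1 : ℝ → ℝ) (Y ω)) μ :=
    ((integrable_const (1 : ℝ)).indicator (hY hA))
  have hint : ∫ ω, A.indicator (1 : ℝ → ℝ) (Y ω) ∂μ = p := by
    rw [← integral_map hY.aemeasurable (f := A.indicator (1 : ℝ → ℝ))
      (measurable_one.indicator hA).aestronglyMeasurable, hmap, integral_indicator_one hA]
  have e : (fun ω => Real.exp (s * (A.indicator 1 (Y ω) - p))) = fun ω =>
      A.indicator (1 : ℝ → ℝ) (Y ω) * (Real.exp (s * (1 - p)) - Real.exp (s * -p)) +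
        Real.exp (s * -p) := by
    funext ω
    by_cases h : Y ω ∈ A <;> simp [h]
  rw [mgf, e, integral_add (hi.mul_const _) (integrable_const _), integral_mul_const, hint,
    integral_const]
  simp
  ring

lemma mgf_cellDev_le (hX : ∀ i, Measurable (X i)) (hmap : ∀ i, μ.map (X i) = P)
    (hind : iIndepFun X μ) (j k : ℕ) {s : ℝ} (hs : |s| ≤ 1) :
    mgf (fun ω => n * cellDev a b P (fun i => X i ω) j k) μ s ≤
      Real.exp (n * (s ^ 2 * P.real (cell a b j k))) := by
  have hm : Measurable fun y : ℝ =>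
      (cell a b j k).indicator (1 : ℝ → ℝ) y - P.real (cell a b j k) :=
    (measurable_one.indicator (measurableSet_cell a b j k)).sub measurable_const
  have h := (hind.comp (fun _ y => (cell a b j k).indicator (1 : ℝ → ℝ) y -
    P.real (cell a b j k)) (fun _ => hm)).mgf_sum (t := s) (fun i => hm.comp (hX i)) Finset.univ
  have e : (fun ω => n * cellDev a b P (fun i => X i ω) j k) =
      ∑ i, ((fun y => (cell a b j k).indicator (1 : ℝ → ℝ) y - P.real (cell a b j k)) ∘ X i) := by
    funext ω
    rw [natCast_mul_cellDev, Finset.sum_apply]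
    rfl
  rw [e, h]
  refine (Finset.prod_le_prod (fun i _ => mgf_nonneg) fun i _ =>
    mgf_indicator_sub_le (measurableSet_cell a b j k) (hX i) (hmap i) hs).trans_eq ?_
  rw [Finset.prod_const, ← Real.exp_nat_mul, Finset.card_univ, Fintype.card_fin]

lemma integrable_exp_cellDev (hX : ∀ i, Measurable (X i)) (j k : ℕ) (s : ℝ) :
    Integrable (fun ω => Real.exp (s * (n * cellDev a b P (fun i => X i ω) j k))) μ := by
  refine Integrable.of_bound (C := Real.exp (|s| * n)) (Real.measurable_exp.comp
    (((measurable_cellDev hX j k).const_mul _).const_mul _)).aestronglyMeasurable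
    (ae_of_all _ fun ω => ?_)
  rw [Real.norm_eq_abs, Real.abs_exp, Real.exp_le_exp]
  refine (le_abs_self _).trans ?_
  rw [abs_mul]
  refine mul_le_mul_of_nonneg_left ?_ (abs_nonneg s)
  rw [natCast_mul_cellDev]
  refine (Finset.abs_sum_le_sum_abs _ _).trans ((Finset.sum_le_sum (g := fun _ => (1 : ℝ))
    fun i _ => ?_).trans_eq (by simp))
  have h0 : 0 ≤ P.real (cell a b j k) := measureReal_nonneg
  have h1 : P.real (cell a b j k) ≤ 1 := measureReal_le_one
  by_cases h : X i ω ∈ cell a b j k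
  · simp only [h, indicator_of_mem, Pi.one_apply]; rw [abs_le]; constructor <;> linarith
  · simp only [h, not_false_eq_true, indicator_of_notMem]; rw [abs_le]; constructor <;> linarith

/-- At level `m + i`, the rescaled deviation of a cell exceeds `t` by an amount whose second
moment is exponentially small in `t`. -/
lemma integral_sq_excess_le (hX : ∀ i, Measurable (X i)) (hmap : ∀ i, μ.map (X i) = P)
    (hind : iIndepFun X μ) {m i k : ℕ} {D : ℝ} (t : ℝ) (hn : (n : ℝ) ≤ 8 ^ (m + 1)) (hi : i ≤ m)
    (hD0 : 0 ≤ D) (hPD : P.real (cell a b (m + i) k) ≤ D / 2 ^ (m + i)) :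
    Integrable (fun ω => (max (|(4 / 3) ^ i / 2 ^ m *
      (n * cellDev a b P (fun i => X i ω) (m + i) k)| - t) 0) ^ 2) μ ∧
    ∫ ω, (max (|(4 / 3) ^ i / 2 ^ m *
      (n * cellDev a b P (fun i => X i ω) (m + i) k)| - t) 0) ^ 2 ∂μ ≤
      4 * Real.exp (8 * D) * Real.exp (-t) := by
  set s : ℝ := (4 / 3) ^ i / 2 ^ m with hs
  set W : Ω → ℝ := fun ω => n * cellDev a b P (fun i => X i ω) (m + i) k with hW
  have hs0 : 0 ≤ s := by positivity
  have hs1 : s ≤ 1 := by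
    rw [hs, div_le_one (by positivity)]
    exact (pow_le_pow_left₀ (by norm_num) (by norm_num : (4 / 3 : ℝ) ≤ 2) i).trans
      (pow_le_pow_right₀ (by norm_num) hi)
  -- the variance proxy stays bounded in `i` because `(4 / 3) ^ 2 < 2`
  have hexp : n * (s ^ 2 * P.real (cell a b (m + i) k)) ≤ 8 * D := by
    have h1 : n * (s ^ 2 * P.real (cell a b (m + i) k)) ≤
        8 ^ (m + 1) * (s ^ 2 * (D / 2 ^ (m + i))) := by gcongr
    refine h1.trans ?_
    have h2 : (8 : ℝ) ^ (m + 1) * (s ^ 2 * (D / 2 ^ (m + i))) = 8 * D * (8 / 9) ^ i := by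
      have h8 : (8 : ℝ) ^ m = 2 ^ m * 2 ^ m * 2 ^ m := by rw [← mul_pow, ← mul_pow]; norm_num
      have h9 : (8 / 9 : ℝ) ^ i = (4 / 3) ^ i * (4 / 3) ^ i / 2 ^ i := by
        rw [← mul_pow, ← div_pow]; norm_num
      rw [hs, h9, pow_succ, h8, pow_add]; field_simp
    rw [h2]
    exact mul_le_of_le_one_right (by positivity) (pow_le_one₀ (by norm_num) (by norm_num))
  have hmgf : ∀ r : ℝ, |r| = s → ∫ ω, Real.exp (r * W ω) ∂μ ≤ Real.exp (8 * D) := by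
    intro r hr
    refine (mgf_cellDev_le hX hmap hind (m + i) k (hr.trans_le hs1)).trans ?_
    rw [Real.exp_le_exp, ← sq_abs, hr]; exact hexp
  have i1 : Integrable (fun ω => Real.exp (s * W ω)) μ := integrable_exp_cellDev hX _ k s
  have i2 : Integrable (fun ω => Real.exp (-s * W ω)) μ := integrable_exp_cellDev hX _ k (-s)
  have hpt : ∀ ω, (max (|s * W ω| - t) 0) ^ 2 ≤
      2 * Real.exp (-t) * (Real.exp (s * W ω) + Real.exp (-s * W ω)) := by
    intro ω
    refine (sq_max_zero_le _).trans ?_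
    have h1 : Real.exp |s * W ω| ≤ Real.exp (s * W ω) + Real.exp (-s * W ω) := by
      rcases abs_cases (s * W ω) with h | h <;> rw [h.1]
      · linarith [Real.exp_pos (-s * W ω)]
      · rw [neg_mul]; linarith [Real.exp_pos (s * W ω)]
    rw [sub_eq_add_neg, Real.exp_add]
    nlinarith [Real.exp_pos (-t)]
  have hmeas : Measurable fun ω => (max (|s * W ω| - t) 0) ^ 2 := by
    have : Measurable W := (measurable_cellDev hX (m + i) k).const_mul _
    fun_prop
  have hR : Integrable (fun ω => 2 * Real.exp (-t) *
      (Real.exp (s * W ω) + Real.exp (-s * W ω))) μ := (i1.add i2).const_mul _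
  have hL : Integrable (fun ω => (max (|s * W ω| - t) 0) ^ 2) μ :=
    hR.mono' hmeas.aestronglyMeasurable (ae_of_all _ fun ω => by
      rw [Real.norm_eq_abs, abs_of_nonneg (sq_nonneg _)]; exact hpt ω)
  refine ⟨hL, (integral_mono hL hR hpt).trans ?_⟩
  rw [integral_const_mul, integral_add i1 i2]
  have h1 := hmgf s (abs_of_nonneg hs0)
  have h2 := hmgf (-s) (by rw [abs_neg, abs_of_nonneg hs0])
  nlinarith [Real.exp_pos (-t)]

/-- The good event fails with probability exponentially small in `T`, by Markov's inequality
for the sum of squared excesses at each level. -/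
theorem measure_not_goodSample_le (hX : ∀ i, Measurable (X i))
    (hmap : ∀ i, μ.map (X i) = P) (hind : iIndepFun X μ) {m : ℕ} {T D : ℝ}
    (hn : (n : ℝ) ≤ 8 ^ (m + 1)) (hT : 1 ≤ T) (hP : ∀ᵐ y ∂P, y ∈ Ioc a b)
    (hPD : ∀ j k, k < 2 ^ j → P.real (cell a b j k) ≤ D / 2 ^ j) :
    μ {ω | ¬ GoodSample a b P (fun i => X i ω) m T} ≤
      ENNReal.ofReal (8 * Real.exp (8 * D) * Real.exp (-T)) := by
  have hD0 : 0 ≤ D := by simpa using measureReal_nonneg.trans (hPD 0 0 (by simp))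
  set S : ℕ → Ω → ℝ := fun i ω => ∑ k ∈ Finset.range (2 ^ (m + i)),
    (max (|(4 / 3) ^ i / 2 ^ m * (n * cellDev a b P (fun i => X i ω) (m + i) k)| -
      3 * T * (i + 1)) 0) ^ 2 with hS
  have hsub : {ω | ¬ GoodSample a b P (fun i => X i ω) m T} ⊆
      (⋃ i : Fin n, {ω | X i ω ∉ Ioc a b}) ∪
        ⋃ i ∈ Finset.range (m + 1), {ω | 2 ^ m / 2 ^ i ≤ S i ω} := by
    intro ω hω
    simp only [mem_ofPred_eq, GoodSample, not_and_or, not_forall, not_le] at hω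
    rcases hω with ⟨i, hi⟩ | ⟨i, hi, h⟩
    · exact Or.inl (mem_iUnion.2 ⟨i, hi⟩)
    · exact Or.inr (mem_iUnion₂.2 ⟨i, Finset.mem_range.2 (Nat.lt_succ_of_le hi), h.le⟩)
  have hnull : μ (⋃ i : Fin n, {ω | X i ω ∉ Ioc a b}) = 0 := by
    rw [measure_iUnion_null_iff]
    intro i
    have h := hP
    rw [← hmap i] at h
    exact ae_iff.1 (ae_of_ae_map (hX i).aemeasurable h)
  have hlevel : ∀ i ∈ Finset.range (m + 1), μ {ω | 2 ^ m / 2 ^ i ≤ S i ω} ≤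
      ENNReal.ofReal (4 * Real.exp (8 * D) * Real.exp (-T) * (1 / 2) ^ i) := by
    intro i hi
    have hi' : i ≤ m := Nat.lt_succ_iff.1 (Finset.mem_range.1 hi)
    have hk := fun k (hk : k ∈ Finset.range (2 ^ (m + i))) => integral_sq_excess_le hX hmap hind
      (3 * T * (i + 1)) hn hi' hD0 (hPD (m + i) k (Finset.mem_range.1 hk))
    have hint : Integrable (S i) μ := integrable_finsetSum _ fun k h => (hk k h).1
    have hle : ∫ ω, S i ω ∂μ ≤
        2 ^ (m + i) * (4 * Real.exp (8 * D) * Real.exp (-(3 * T * (i + 1)))) := by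
      rw [hS, integral_finsetSum _ fun k h => (hk k h).1]
      refine (Finset.sum_le_sum fun k h => (hk k h).2).trans_eq ?_
      simp
    have hmar := mul_meas_ge_le_integral_of_nonneg
      (ae_of_all _ fun ω => Finset.sum_nonneg fun k _ => sq_nonneg _) hint (2 ^ m / 2 ^ i)
    rw [← ofReal_measureReal]
    refine ENNReal.ofReal_le_ofReal ?_
    -- Markov's inequality loses a factor `4 ^ i` (number of cells over allowed excess), which the
    -- factor `3` in the thresholds recovers since `exp (-3) ≤ 1 / 8`
    have h1 : Real.exp (-(3 * T * (i + 1))) ≤ Real.exp (-T) * (1 / 8) ^ i := by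
      have h3 : Real.exp (-3) ≤ 1 / 8 := by
        rw [Real.exp_neg, one_div]
        refine inv_anti₀ (by norm_num) ?_
        have h2 : (2 : ℝ) ≤ Real.exp 1 := by linarith [Real.add_one_le_exp (1 : ℝ)]
        calc (8 : ℝ) = 2 ^ 3 := by norm_num
          _ ≤ Real.exp 1 ^ 3 := pow_le_pow_left₀ (by norm_num) h2 3
          _ = Real.exp 3 := by rw [← Real.exp_nat_mul]; norm_num
      calc Real.exp (-(3 * T * (i + 1))) ≤ Real.exp (-T + i * (-3)) := by
            rw [Real.exp_le_exp]
            have : (0 : ℝ) ≤ i := Nat.cast_nonneg i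
            nlinarith
        _ = Real.exp (-T) * Real.exp (-3) ^ i := by rw [Real.exp_add, Real.exp_nat_mul]
        _ ≤ _ := by gcongr
    have h2 : μ.real {ω | 2 ^ m / 2 ^ i ≤ S i ω} ≤
        (2 ^ (m + i) * (4 * Real.exp (8 * D) * Real.exp (-(3 * T * (i + 1))))) /
          (2 ^ m / 2 ^ i) := by
      rw [le_div_iff₀ (by positivity), mul_comm]
      exact hmar.trans hle
    refine h2.trans ?_
    have h3 : (2 ^ (m + i) * (4 * Real.exp (8 * D) * Real.exp (-(3 * T * (i + 1))))) /
        (2 ^ m / 2 ^ i) = 4 * Real.exp (8 * D) * 4 ^ i * Real.exp (-(3 * T * (i + 1))) := by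
      have : (4 : ℝ) ^ i = 2 ^ i * 2 ^ i := by rw [← mul_pow]; norm_num
      rw [this, pow_add]; field_simp
    rw [h3]
    refine (mul_le_mul_of_nonneg_left h1 (by positivity)).trans_eq ?_
    have h4 : (1 / 2 : ℝ) ^ i = 4 ^ i * (1 / 8) ^ i := by rw [← mul_pow]; norm_num
    rw [h4]; ring
  refine (measure_mono hsub).trans ((measure_union_le _ _).trans ?_)
  rw [hnull, zero_add]
  refine (measure_biUnion_finset_le _ _).trans ((Finset.sum_le_sum hlevel).trans ?_)
  rw [← ENNReal.ofReal_sum_of_nonneg fun i _ => by positivity, ← Finset.mul_sum]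
  refine ENNReal.ofReal_le_ofReal ?_
  have hgeo : ∑ i ∈ Finset.range (m + 1), (1 / 2 : ℝ) ^ i ≤ 2 := by
    have := geom_sum_eq (by norm_num : (1 / 2 : ℝ) ≠ 1) (m + 1)
    have e : ((1 / 2 : ℝ) ^ (m + 1) - 1) / (1 / 2 - 1) = 2 - 2 * (1 / 2) ^ (m + 1) := by ring
    rw [this, e]
    have : (0 : ℝ) < (1 / 2) ^ (m + 1) := by positivity
    linarith
  have := mul_le_mul_of_nonneg_left hgeo
    (by positivity : 0 ≤ 4 * Real.exp (8 * D) * Real.exp (-T))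
  linarith

end Moments

/-! ### Densities of log-bounded variation -/

section Densities

variable {a b : ℝ} {f f₀ : ℝ → ℝ}

/-- The map `s ↦ ½ log ((1 + s²) / 2)` is dominated by `|s - 1|`. -/
lemma abs_half_log_le {s : ℝ} (hs : 0 < s) : |1 / 2 * Real.log ((1 + s ^ 2) / 2)| ≤ |s - 1| := by
  have h0 : 0 < (1 + s ^ 2) / 2 := by positivity
  have hlow := Real.one_sub_inv_le_log_of_pos h0
  rcases le_total 1 s with h | h
  · rw [abs_of_nonneg (sub_nonneg.2 h), abs_of_nonneg]
    · have h1 : Real.log ((1 + s ^ 2) / 2) ≤ Real.log (s ^ 2) :=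
        Real.log_le_log h0 (by nlinarith)
      rw [Real.log_pow] at h1
      have h2 := Real.log_le_sub_one_of_pos hs
      push_cast at h1
      linarith
    · have : 0 ≤ Real.log ((1 + s ^ 2) / 2) := Real.log_nonneg (by nlinarith)
      positivity
  · rw [abs_of_nonpos (sub_nonpos.2 h), abs_of_nonpos]
    · have h1 : ((1 + s ^ 2) / 2)⁻¹ ≤ 1 + 2 * (1 - s) := by
        rw [inv_le_iff_one_le_mul₀ h0]
        nlinarith [mul_nonneg (sub_nonneg.2 h) (sq_nonneg (s - 1 / 2)),
          mul_nonneg (sub_nonneg.2 h) (sq_nonneg s)]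
      linarith
    · have : Real.log ((1 + s ^ 2) / 2) ≤ 0 := Real.log_nonpos h0.le (by nlinarith)
      linarith

/-- The pointwise comparison of `p_f` with the integrand of the Hellinger distance. -/
lemma sq_pFun_mul_le {x : ℝ} (hf : 0 < f x) (hf₀ : 0 < f₀ x) :
    pFun f₀ f x ^ 2 * f₀ x ≤ (√(f x) - √(f₀ x)) ^ 2 := by
  have h1 := Real.sqrt_pos.2 hf
  have h2 := Real.sqrt_pos.2 hf₀
  have e1 := Real.sq_sqrt hf.le
  have e2 := Real.sq_sqrt hf₀.le
  have e : pFun f₀ f x = 1 / 2 * Real.log ((1 + (√(f x) / √(f₀ x)) ^ 2) / 2) := by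
    rw [pFun, div_pow, e1, e2]; congr 2; field_simp; ring
  have h := sq_le_sq' (abs_le.1 (abs_half_log_le (div_pos h1 h2))).1
    (abs_le.1 (abs_half_log_le (div_pos h1 h2))).2
  rw [sq_abs, ← e] at h
  calc pFun f₀ f x ^ 2 * f₀ x ≤ (√(f x) / √(f₀ x) - 1) ^ 2 * f₀ x :=
        mul_le_mul_of_nonneg_right h hf₀.le
    _ = (√(f x) / √(f₀ x) - 1) ^ 2 * √(f₀ x) ^ 2 := by rw [e2]
    _ = _ := by rw [← mul_pow]; congr 1; field_simp

/-- `u ↦ log (1 + exp u)` is `1`-Lipschitz. -/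
lemma abs_log_one_add_exp_sub_le (u v : ℝ) :
    |Real.log (1 + Real.exp u) - Real.log (1 + Real.exp v)| ≤ |u - v| := by
  have key : ∀ u v : ℝ, u ≤ v →
      |Real.log (1 + Real.exp u) - Real.log (1 + Real.exp v)| ≤ |u - v| := by
    intro u v h
    have hu : 0 < 1 + Real.exp u := by positivity
    have h1 : Real.log (1 + Real.exp u) ≤ Real.log (1 + Real.exp v) :=
      Real.log_le_log hu (by have := Real.exp_le_exp.2 h; linarith)
    have h2 : Real.log (1 + Real.exp v) ≤ (v - u) + Real.log (1 + Real.exp u) := by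
      rw [← Real.log_exp (v - u), ← Real.log_mul (Real.exp_pos _).ne' hu.ne']
      refine Real.log_le_log (by positivity) ?_
      rw [mul_add, ← Real.exp_add, sub_add_cancel]
      have : 1 ≤ Real.exp (v - u) := Real.one_le_exp (by linarith)
      linarith
    rw [abs_of_nonpos (by linarith), abs_of_nonpos (by linarith)]
    linarith
  rcases le_total u v with h | h
  · exact key u v h
  · rw [abs_sub_comm, abs_sub_comm u]; exact key v u h

lemma abs_pFun_sub_le {x y : ℝ} (hfx : 0 < f x) (hfy : 0 < f y) (hx : 0 < f₀ x) (hy : 0 < f₀ y) :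
    |pFun f₀ f x - pFun f₀ f y| ≤
      |Real.log (f x) - Real.log (f y)| + |Real.log (f₀ x) - Real.log (f₀ y)| := by
  have e : ∀ z, 0 < f z → 0 < f₀ z → pFun f₀ f z =
      1 / 2 * (Real.log (1 + Real.exp (Real.log (f z) - Real.log (f₀ z))) - Real.log 2) := by
    intro z h1 h2
    rw [pFun, Real.exp_sub, Real.exp_log h1, Real.exp_log h2, ← Real.log_div (by positivity)
      (by norm_num)]
    congr 2; field_simp; ring
  rw [e x hfx hx, e y hfy hy]
  have h := abs_log_one_add_exp_sub_le (Real.log (f x) - Real.log (f₀ x))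
    (Real.log (f y) - Real.log (f₀ y))
  have h2 := abs_sub (Real.log (f x) - Real.log (f y)) (Real.log (f₀ x) - Real.log (f₀ y))
  have h3 : Real.log (f x) - Real.log (f₀ x) - (Real.log (f y) - Real.log (f₀ y)) =
      Real.log (f x) - Real.log (f y) - (Real.log (f₀ x) - Real.log (f₀ y)) := by ring
  rw [h3] at h
  rw [← mul_sub, sub_sub_sub_cancel_right, abs_mul, abs_of_pos (by norm_num : (0 : ℝ) < 1 / 2)]
  have := abs_nonneg (Real.log (1 + Real.exp (Real.log (f x) - Real.log (f₀ x))) -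
    Real.log (1 + Real.exp (Real.log (f y) - Real.log (f₀ y))))
  linarith

lemma eVariationOn_le_mul_add {q g h : ℝ → ℝ} {s : Set ℝ} {c : ℝ} (hc : 0 ≤ c)
    (hq : ∀ x ∈ s, ∀ y ∈ s, |q x - q y| ≤ c * (|g x - g y| + |h x - h y|)) :
    eVariationOn q s ≤ ENNReal.ofReal c * (eVariationOn g s + eVariationOn h s) := by
  refine iSup_le fun p => ?_
  have h1 : ∀ i, edist (q (p.2.1 (i + 1))) (q (p.2.1 i)) ≤ ENNReal.ofReal c *
      (edist (g (p.2.1 (i + 1))) (g (p.2.1 i)) + edist (h (p.2.1 (i + 1))) (h (p.2.1 i))) := by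
    intro i
    simp only [edist_dist, Real.dist_eq]
    rw [← ENNReal.ofReal_add (abs_nonneg _) (abs_nonneg _), ← ENNReal.ofReal_mul hc]
    exact ENNReal.ofReal_le_ofReal (hq _ (p.2.2.2 _) _ (p.2.2.2 _))
  refine (Finset.sum_le_sum fun i _ => h1 i).trans ?_
  rw [← Finset.mul_sum, Finset.sum_add_distrib]
  gcongr
  · exact eVariationOn.sum_le p.2.2.1 p.2.2.2
  · exact eVariationOn.sum_le p.2.2.1 p.2.2.2

lemma _root_.BoundedVariationOn.exists_abs_le {g : ℝ → ℝ} (hab : a ≤ b)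
    (hg : BoundedVariationOn g (Icc a b)) : ∃ B, ∀ x ∈ Icc a b, |g x| ≤ B := by
  refine ⟨|g a| + (eVariationOn g (Icc a b)).toReal, fun x hx => ?_⟩
  have h := hg.dist_le hx (left_mem_Icc.2 hab)
  rw [Real.dist_eq] at h
  have := abs_add_le (g a) (g x - g a)
  rw [add_sub_cancel] at this
  linarith

lemma IsLogBVDensity.integrableOn (hf : IsLogBVDensity a b f) : IntegrableOn f (Icc a b) := by
  by_contra h
  have := hf.integral_eq_one
  rw [integral_undef h] at this
  exact zero_ne_one this

lemma IsLogBVDensity.exists_exp_bounds (hab : a ≤ b) (hf : IsLogBVDensity a b f) :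
    ∃ B, ∀ x ∈ Icc a b, Real.exp (-B) ≤ f x ∧ f x ≤ Real.exp B := by
  obtain ⟨B, hB⟩ := hf.bv.exists_abs_le hab
  refine ⟨B, fun x hx => ?_⟩
  have h := abs_le.1 (hB x hx)
  rw [← Real.le_log_iff_exp_le (hf.pos x hx), ← Real.log_le_iff_le_exp (hf.pos x hx)]
  exact h

lemma one_le_J : 1 ≤ J a b f₀ f := by
  have h1 : 0 ≤ logTV a b f := ENNReal.toReal_nonneg
  have h2 : 0 ≤ logTV a b f₀ := ENNReal.toReal_nonneg
  rw [J]; linarith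

/-- After division by `J(f)`, the function `p_f` has total variation at most `1`. -/
lemma eVariationOn_pFun_div_J_le (hf₀ : IsLogBVDensity a b f₀) (hf : IsLogBVDensity a b f) :
    eVariationOn (fun x => pFun f₀ f x / J a b f₀ f) (Icc a b) ≤ 1 := by
  have hJ : 0 < J a b f₀ f := zero_lt_one.trans_le one_le_J
  refine (eVariationOn_le_mul_add (c := (J a b f₀ f)⁻¹) (by positivity)
    (g := fun x => Real.log (f x)) (h := fun x => Real.log (f₀ x)) ?_).trans ?_
  · intro x hx y hy
    rw [← sub_div, abs_div, abs_of_pos hJ, div_eq_inv_mul]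
    exact mul_le_mul_of_nonneg_left (abs_pFun_sub_le (hf.pos x hx) (hf.pos y hy) (hf₀.pos x hx)
      (hf₀.pos y hy)) (by positivity)
  · rw [← ENNReal.ofReal_toReal hf.bv, ← ENNReal.ofReal_toReal hf₀.bv,
      ← ENNReal.ofReal_add ENNReal.toReal_nonneg ENNReal.toReal_nonneg,
      ← ENNReal.ofReal_mul (by positivity), ← ENNReal.ofReal_one]
    refine ENNReal.ofReal_le_ofReal ?_
    rw [inv_mul_le_iff₀ hJ, J, logTV, logTV]
    linarith

lemma aestronglyMeasurable_pFun (hf₀ : IsLogBVDensity a b f₀) (hf : IsLogBVDensity a b f) :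
    AEStronglyMeasurable (pFun f₀ f) (volume.restrict (Icc a b)) := by
  have h1 := hf.integrableOn.aestronglyMeasurable.aemeasurable
  have h2 := hf₀.integrableOn.aestronglyMeasurable.aemeasurable
  unfold pFun
  exact ((Real.measurable_log.comp_aemeasurable
    ((h1.add h2).div (h2.const_mul 2))).const_mul (1 / 2)).aestronglyMeasurable

/-- The squared `L²` norm of `p_f` is dominated by the squared Hellinger distance. -/
lemma integral_sq_pFun_le {B : ℝ} (hf₀ : IsLogBVDensity a b f₀)
    (hf : IsLogBVDensity a b f) (hB : ∀ x ∈ Icc a b, Real.exp (-B) ≤ f₀ x) :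
    ∫ x in Icc a b, pFun f₀ f x ^ 2 ≤ 2 * Real.exp B * hellinger a b f f₀ ^ 2 := by
  have h1 := hf.integrableOn
  have h2 := hf₀.integrableOn
  have hI : IntegrableOn (fun x => (√(f x) - √(f₀ x)) ^ 2) (Icc a b) := by
    refine (h1.add h2).mono' ?_ ?_
    · have := h1.aestronglyMeasurable.aemeasurable
      have := h2.aestronglyMeasurable.aemeasurable
      exact AEMeasurable.aestronglyMeasurable (by fun_prop)
    · refine (ae_restrict_iff' measurableSet_Icc).2 (ae_of_all _ fun x hx => ?_)
      rw [Real.norm_eq_abs, abs_of_nonneg (sq_nonneg _)]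
      have e1 := Real.sq_sqrt (hf.pos x hx).le
      have e2 := Real.sq_sqrt (hf₀.pos x hx).le
      have := mul_nonneg (Real.sqrt_nonneg (f x)) (Real.sqrt_nonneg (f₀ x))
      simp only [Pi.add_apply]
      nlinarith
  rw [hellinger, Real.sq_sqrt (mul_nonneg (by norm_num) (integral_nonneg fun x => sq_nonneg _))]
  have e : 2 * Real.exp B * (1 / 2 * ∫ x in Icc a b, (√(f x) - √(f₀ x)) ^ 2) =
      ∫ x in Icc a b, Real.exp B * (√(f x) - √(f₀ x)) ^ 2 := by
    rw [integral_const_mul]; ring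
  rw [e]
  refine integral_mono_of_nonneg (ae_of_all _ fun x => sq_nonneg _) (hI.const_mul _) ?_
  refine (ae_restrict_iff' measurableSet_Icc).2 (ae_of_all _ fun x hx => ?_)
  have h3 := sq_pFun_mul_le (hf.pos x hx) (hf₀.pos x hx)
  have h4 := mul_le_mul_of_nonneg_left (hB x hx) (sq_nonneg (pFun f₀ f x))
  have h5 := mul_le_mul_of_nonneg_left (h4.trans h3) (Real.exp_pos B).le
  have h6 : Real.exp B * (pFun f₀ f x ^ 2 * Real.exp (-B)) = pFun f₀ f x ^ 2 := by
    rw [Real.exp_neg]; field_simp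
  simpa only [h6] using h5

/-! ### The sampling law -/

lemma isProbabilityMeasure_law (hf₀ : IsLogBVDensity a b f₀) :
    IsProbabilityMeasure (law a b f₀) := by
  constructor
  rw [law, withDensity_apply _ MeasurableSet.univ, Measure.restrict_univ,
    ← ofReal_integral_eq_lintegral_ofReal hf₀.integrableOn
      ((ae_restrict_iff' measurableSet_Icc).2 (ae_of_all _ fun x hx => (hf₀.pos x hx).le)),
    hf₀.integral_eq_one, ENNReal.ofReal_one]

lemma law_absolutelyContinuous (a b : ℝ) (f₀ : ℝ → ℝ) :
    law a b f₀ ≪ volume.restrict (Icc a b) :=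
  withDensity_absolutelyContinuous _ _

lemma ae_law_mem_Ioc (a b : ℝ) (f₀ : ℝ → ℝ) : ∀ᵐ y ∂law a b f₀, y ∈ Ioc a b := by
  refine (law_absolutelyContinuous a b f₀).ae_le ?_
  rw [← restrict_Ioc_eq_restrict_Icc]
  exact ae_restrict_mem measurableSet_Ioc

lemma law_real_cell_le {B : ℝ} (hab : a ≤ b) (hB : ∀ x ∈ Icc a b, f₀ x ≤ Real.exp B) {j k : ℕ}
    (hk : k < 2 ^ j) : (law a b f₀).real (cell a b j k) ≤ Real.exp B * (b - a) / 2 ^ j := by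
  have h0 : 0 ≤ (b - a) / 2 ^ j := div_nonneg (sub_nonneg.2 hab) (by positivity)
  have h : law a b f₀ (cell a b j k) ≤ ENNReal.ofReal (Real.exp B * (b - a) / 2 ^ j) := by
    rw [law, withDensity_apply _ (measurableSet_cell a b j k),
      Measure.restrict_restrict (measurableSet_cell a b j k),
      inter_eq_left.2 (cell_subset hab hk)]
    refine (setLIntegral_mono (g := fun _ => ENNReal.ofReal (Real.exp B)) measurable_const
      fun x hx => ENNReal.ofReal_le_ofReal (hB x (cell_subset hab hk hx))).trans ?_
    rw [setLIntegral_const, cell, Real.volume_Ioc, gridPt_succ_sub,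
      ← ENNReal.ofReal_mul (Real.exp_pos B).le, mul_div_assoc]
  refine ENNReal.toReal_le_of_le_ofReal ?_ h
  rw [mul_div_assoc]; positivity

/-- On the good event the supremum `Z_n` is of order `T`. -/
theorem supDeviation_le_of_goodSample (hab : a < b) (hf₀ : IsLogBVDensity a b f₀) {B : ℝ}
    (hB : ∀ x ∈ Icc a b, Real.exp (-B) ≤ f₀ x ∧ f₀ x ≤ Real.exp B) {n m : ℕ} {x : Fin n → ℝ}
    {T : ℝ} (hn1 : (8 : ℝ) ^ m ≤ n) (hn2 : (n : ℝ) ≤ 8 ^ (m + 1)) (hT : 1 ≤ T)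
    (hx : GoodSample a b (law a b f₀) x m T) :
    supDeviation a b f₀ x ≤ ENNReal.ofReal
      (4 * (112 * (2 * Real.exp B / (b - a)) + 192 + 2 * (Real.exp B * (b - a))) * T) := by
  have hba : 0 < b - a := sub_pos.2 hab
  have hPr := isProbabilityMeasure_law hf₀
  refine iSup_le fun f => iSup_le fun hf => iSup_le fun hh => ENNReal.ofReal_le_ofReal ?_
  have hJ1 : 1 ≤ J a b f₀ f := one_le_J
  set Jf := J a b f₀ f with hJf
  have hJ : 0 < Jf := zero_lt_one.trans_le hJ1
  set q : ℝ → ℝ := fun x => pFun f₀ f x / Jf with hq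
  have hV : eVariationOn q (Icc a b) ≤ 1 := eVariationOn_pFun_div_J_le hf₀ hf
  have hbv : BoundedVariationOn q (Icc a b) := ne_top_of_le_ne_top ENNReal.one_ne_top hV
  obtain ⟨C, hC⟩ := hbv.exists_abs_le hab.le
  have hqm : AEStronglyMeasurable q (volume.restrict (Icc a b)) := by
    simpa only [hq, div_eq_mul_inv] using (aestronglyMeasurable_pFun hf₀ hf).mul_const Jf⁻¹
  have hqI : IntegrableOn q (Icc a b) := Integrable.of_bound hqm C
    ((ae_restrict_iff' measurableSet_Icc).2 (ae_of_all _ fun x hx => hC x hx))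
  have hqI2 : IntegrableOn (fun x => q x ^ 2) (Icc a b) :=
    Integrable.of_bound (hqm.pow 2) (C ^ 2)
      ((ae_restrict_iff' measurableSet_Icc).2 (ae_of_all _ fun x hx => by
        rw [norm_pow]; exact pow_le_pow_left₀ (norm_nonneg _) (hC x hx) 2))
  have hqP : Integrable q (law a b f₀) :=
    Integrable.of_bound (hqm.mono_ac (law_absolutelyContinuous a b f₀)) C
      ((ae_law_mem_Ioc a b f₀).mono fun x hx => hC x (Ioc_subset_Icc_self hx))
  -- the Hellinger constraint localizes `q` in `L²`
  have hn0 : (0 : ℝ) < n := lt_of_lt_of_le (by positivity) hn1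
  have hloc : ((n : ℝ) ^ (-(1 / 3) : ℝ)) ^ 2 ≤ 1 / 4 ^ m := by
    have h1 : (n : ℝ) ^ (-(1 / 3) : ℝ) ≤ ((8 : ℝ) ^ m) ^ (-(1 / 3) : ℝ) :=
      Real.rpow_le_rpow_of_nonpos (by positivity) hn1 (by norm_num)
    have h2 : ((8 : ℝ) ^ m) ^ (-(1 / 3) : ℝ) = (2 ^ m)⁻¹ := by
      have : (8 : ℝ) ^ m = (2 ^ m) ^ (3 : ℝ) := by
        rw [Real.rpow_ofNat, ← pow_mul, mul_comm, pow_mul]; norm_num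
      rw [this, ← Real.rpow_mul (by positivity)]
      norm_num [Real.rpow_neg_one]
    rw [h2] at h1
    refine (pow_le_pow_left₀ (by positivity) h1 2).trans_eq ?_
    rw [inv_pow, ← pow_mul, mul_comm, pow_mul, one_div]; norm_num
  have hrate : (n : ℝ) ^ (2 / 3 : ℝ) ≤ 4 * 4 ^ m := by
    refine (Real.rpow_le_rpow hn0.le hn2 (by norm_num)).trans_eq ?_
    have : (8 : ℝ) ^ (m + 1) = (2 ^ (m + 1)) ^ (3 : ℝ) := by
      rw [Real.rpow_ofNat, ← pow_mul, mul_comm, pow_mul]; norm_num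
    rw [this, ← Real.rpow_mul (by positivity)]
    norm_num
    rw [← pow_mul, mul_comm, pow_mul, pow_succ]; norm_num; ring
  have hL2 : ∫ x in Icc a b, q x ^ 2 ≤ 2 * Real.exp B / (b - a) * (b - a) / 4 ^ m := by
    rw [div_mul_cancel₀ _ hba.ne']
    have h1 := integral_sq_pFun_le hf₀ hf fun x hx => (hB x hx).1
    have h2 : hellinger a b f f₀ ^ 2 ≤ 1 / 4 ^ m * Jf ^ 2 := by
      refine (pow_le_pow_left₀ (Real.sqrt_nonneg _) hh 2).trans ?_
      rw [mul_pow]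
      exact mul_le_mul_of_nonneg_right hloc (sq_nonneg _)
    simp only [hq, div_pow]
    rw [integral_div, div_le_iff₀ (by positivity)]
    refine h1.trans ((mul_le_mul_of_nonneg_left h2 (by positivity)).trans_eq ?_)
    ring
  have key := abs_deviation_le_of_goodSample hab hn1 hT hx (ae_law_mem_Ioc a b f₀)
    (fun j k hk => law_real_cell_le hab.le (fun x hx => (hB x hx).2) hk) hqI hqI2 hbv
    (ENNReal.toReal_le_of_le_ofReal zero_le_one (by simpa using hV)) hqP hL2
  have e : |empMean x q - ∫ y, q y ∂law a b f₀| =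
      |empMean x (pFun f₀ f) - ∫ t, pFun f₀ f t ∂(law a b f₀)| / Jf := by
    have h1 : empMean x q = empMean x (pFun f₀ f) / Jf := by
      simp only [empMean, hq]; rw [← Finset.sum_div]; ring
    rw [h1, hq, integral_div, ← sub_div, abs_div, abs_of_pos hJ]
  rw [mul_div_assoc, ← e]
  set K := 112 * (2 * Real.exp B / (b - a)) + 192 + 2 * (Real.exp B * (b - a))
  refine (mul_le_mul hrate key (abs_nonneg _) (by positivity)).trans_eq ?_
  field_simp

/-- The exponential tail bound for `Z_n`, with constants depending only on `a`, `b` and `f₀`. -/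
theorem exists_measure_supDeviation_le (hab : a < b) (hf₀ : IsLogBVDensity a b f₀) :
    ∃ c₀ : ℝ, 0 < c₀ ∧ ∀ n : ℕ, 1 ≤ n → ∀ T : ℝ, c₀ ^ 2 ≤ T →
      ∀ (Ω : Type u) [MeasurableSpace Ω] (μ : Measure Ω) [IsProbabilityMeasure μ]
        (X : Fin n → Ω → ℝ), IsIIDSample μ a b f₀ X →
        μ {ω | ENNReal.ofReal T ≤ supDeviation a b f₀ (fun i => X i ω)} ≤
          ENNReal.ofReal (c₀ * Real.exp (-(T / c₀ ^ 2))) := by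
  have hba : 0 < b - a := sub_pos.2 hab
  obtain ⟨B, hB⟩ := hf₀.exists_exp_bounds hab.le
  have hPr := isProbabilityMeasure_law hf₀
  set K := 4 * (112 * (2 * Real.exp B / (b - a)) + 192 + 2 * (Real.exp B * (b - a))) with hK
  have hK0 : 0 < K := by positivity
  set A := 8 * Real.exp (8 * (Real.exp B * (b - a))) with hA
  have hA0 : 0 < A := by positivity
  -- `K` is the constant of the bound on the good event, `A` that of its failure probability;
  -- the good event is used with parameter `T / c₀ ^ 2`, so `K < c₀ ^ 2` and `A ≤ c₀` are needed
  refine ⟨A + K + 1, by positivity, fun n hn T hT Ω _ μ _ X hX => ?_⟩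
  set c₀ := A + K + 1 with hc₀
  have hc0 : 0 < c₀ := by positivity
  set m := Nat.log 8 n with hm
  have hn1 : (8 : ℝ) ^ m ≤ n := by exact_mod_cast Nat.pow_log_le_self 8 (by omega)
  have hn2 : (n : ℝ) ≤ 8 ^ (m + 1) := by
    exact_mod_cast (Nat.lt_pow_succ_log_self (by norm_num) n).le
  have hτ : 1 ≤ T / c₀ ^ 2 := (one_le_div (by positivity)).2 hT
  have hsub : {ω | ENNReal.ofReal T ≤ supDeviation a b f₀ (fun i => X i ω)} ⊆
      {ω | ¬ GoodSample a b (law a b f₀) (fun i => X i ω) m (T / c₀ ^ 2)} := by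
    intro ω hω hgood
    have h1 := le_trans (mem_ofPred_eq ▸ hω)
      (supDeviation_le_of_goodSample hab hf₀ hB hn1 hn2 hτ hgood)
    have hT0 : 0 < T := lt_of_lt_of_le (by positivity) hT
    rw [← hK, ENNReal.ofReal_le_ofReal_iff (by positivity)] at h1
    have h2 : K * (T / c₀ ^ 2) < T := by
      rw [← mul_div_assoc, div_lt_iff₀ (by positivity), mul_comm]
      refine mul_lt_mul_of_pos_left ?_ hT0
      nlinarith
    linarith
  refine (measure_mono hsub).trans ((measure_not_goodSample_le hX.measurable hX.map_eq
    hX.indep hn2 hτ (ae_law_mem_Ioc a b f₀)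
    (fun j k hk => law_real_cell_le hab.le (fun x hx => (hB x hx).2) hk)).trans ?_)
  refine ENNReal.ofReal_le_ofReal ?_
  rw [← hA]
  exact mul_le_mul_of_nonneg_right (by linarith) (Real.exp_pos _).le

end Densities

end FusedDensity

theorem mainTheorem4 (a b : ℝ) (hab : a < b) (f₀ : ℝ → ℝ)
    (hf₀ : FusedDensity.IsLogBVDensity a b f₀) :
    (∀ (Ω : Type u) [MeasurableSpace Ω] (μ : Measure Ω) [IsProbabilityMeasure μ]
        (X : ℕ → Ω → ℝ), FusedDensity.IsIIDSample μ a b f₀ X →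
        FusedDensity.IsBigOPOne μ
          (fun n ω => FusedDensity.supDeviation a b f₀ (fun i : Fin n => X i ω))) ∧
    (∃ (n₀ : ℕ) (t₀ c₀ : ℝ), 0 < c₀ ∧
      ∀ (n : ℕ), n₀ ≤ n → ∀ (T : ℝ), t₀ ≤ T →
        ∀ (Ω : Type u) [MeasurableSpace Ω] (μ : Measure Ω) [IsProbabilityMeasure μ]
          (X : Fin n → Ω → ℝ), FusedDensity.IsIIDSample μ a b f₀ X →
          μ {ω | ENNReal.ofReal T ≤ FusedDensity.supDeviation a b f₀ (fun i => X i ω)} ≤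
            ENNReal.ofReal (c₀ * Real.exp (-(T / c₀ ^ 2)))) := by
  obtain ⟨c₀, hc₀, h⟩ := FusedDensity.exists_measure_supDeviation_le.{u} hab hf₀
  refine ⟨fun Ω _ μ _ X hX ε hε => ?_, 1, c₀ ^ 2, c₀, hc₀, h⟩
  have hlim : Tendsto (fun T : ℝ => c₀ * Real.exp (-(T / c₀ ^ 2))) atTop (nhds 0) := by
    have h1 : Tendsto (fun T : ℝ => T / c₀ ^ 2) atTop atTop :=
      tendsto_id.atTop_div_const (by positivity)
    simpa using (Real.tendsto_exp_neg_atTop_nhds_zero.comp h1).const_mul c₀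
  obtain ⟨T, hT, hTε⟩ :=
    ((eventually_ge_atTop (c₀ ^ 2)).and (hlim.eventually (gt_mem_nhds hε))).exists
  refine ⟨T, 1, fun n hn => ?_⟩
  have hXn : FusedDensity.IsIIDSample μ a b f₀ (fun i : Fin n => X i) :=
    ⟨fun i => hX.measurable i, fun i => hX.map_eq i, hX.indep.precomp Fin.val_injective⟩
  have hsub : {ω | ENNReal.ofReal T < FusedDensity.supDeviation a b f₀ (fun i : Fin n => X i ω)} ⊆
      {ω | ENNReal.ofReal T ≤ FusedDensity.supDeviation a b f₀ (fun i : Fin n => X i ω)} :=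
    fun ω hω => by
      simp only [mem_ofPred_eq] at hω ⊢
      exact hω.le
  exact ((measure_mono hsub).trans (h n hn T hT Ω μ _ hXn)).trans_lt
    ((ENNReal.ofReal_lt_ofReal_iff hε).2 hTε)
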